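/- Let $\beta\approx 1.8393$ be the tribonacci number, i.e. the unique root in $(1,2)$ of $x^3=x^2+x+1$, and let $T_\beta:[0,1)\to[0,1)$, $T_\beta(x)=\beta x \pmod 1$. For $t\in[0,1)$ let $$K_\beta(t)=\{x\in[0,1): T_\beta^n(x)\ge t\ \text{ for all } n\ge 0\},$$ and for an integer $p\ge 1$ let $$S_\beta(p)=\sup\{t\in[0,1): K_\beta(t)\text{ contains a periodic point of } T_\beta \text{ of smallest period } p\}.$$ Then, for every $p\ge1$, the set in this supremum is non-empty, and the values of $S_\beta(p)$ are as follows. * $S_\beta(1)=0$, $\;S_\beta(3)=\dfrac{1}{\beta^3-1}$, $\;S_\beta(4)=\dfrac{1+\beta}{\beta^4-1}$, $\;S_\beta(6)=\dfrac{1+\beta^2+\beta^3}{\beta^6-1}$. * For every integer $m\ge 0$, $$S_\beta(3m+2)=\frac{1+\beta-\beta^{3m+1}-\beta^{3m+3}}{(1-\beta^3)(\beta^{3m+2}-1)}.$$ * For every integer $z\ge1$, $$S_\beta(6z+1)=\frac{1+\beta+\beta^{3z+2}-\beta^{3z+1}-\beta^{6z}-\beta^{6z+2}}{(1-\beta^3)(\beta^{6z+1}-1)},$$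 $$S_\beta(6z+4)=\frac{1+\beta+\beta^{3z+5}-\beta^{3z+4}-\beta^{6z+3}-\beta^{6z+5}}{(1-\beta^3)(\beta^{6z+4}-1)}.$$ * For every integer $z\ge1$, $$S_\beta(9z)=\frac{1+\beta+\beta^{3z+2}+\beta^{6z+1}-\beta^{3z+1}-\beta^{6z}-\beta^{9z-1}-\beta^{9z+1}}{(1-\beta^3)(\beta^{9z}-1)},$$ $$S_\beta(9z+3)=\frac{1+\beta+\beta^{3z+2}+\beta^{6z+4}-\beta^{3z+1}-\beta^{6z+3}-\beta^{9z+2}-\beta^{9z+4}}{(1-\beta^3)(\beta^{9z+3}-1)},$$ $$S_\beta(9z+6)=\frac{1+\beta+\beta^{3z+2}+\beta^{6z+7}-\beta^{3z+1}-\beta^{6z+6}-\beta^{9z+5}-\beta^{9z+7}}{(1-\beta^3)(\beta^{9z+6}-1)}.$$ Moreover, $S_\beta(p)$ is strictly increasing in $p$ along each residue class of $p\ge 1$ modulo $3$, and $$\lim_{p\to\infty}S_\beta(p)=\frac{\beta^2+1}{\beta^4-\beta}\approx 0.45631,$$ where the approximation means that the limit differs from $0.45631$ by less than $5\cdot10^{-6}$.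 -/

import Mathlib

open Filter Topology

noncomputable section

/-- The transformation `x ↦ β x (mod 1)`. As a map of `ℝ` it sends everything into `[0, 1)`;
it is only ever used on points of `[0, 1)`. -/
def betaMap (β : ℝ) (x : ℝ) : ℝ := Int.fract (β * x)

/-- The survivor set of `betaMap β` on `[0, 1)` with a hole at the origin of size `t`:
the points of `[0, 1)` whose whole forward orbit stays `≥ t`. -/
def survivorSet (β t : ℝ) : Set ℝ :=
  {x | x ∈ Set.Ico (0 : ℝ) 1 ∧ ∀ n : ℕ, t ≤ (betaMap β)^[n] x}

/-- The `t ∈ [0, 1)` for which the survivor set contains a periodic point whose smallest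
period is `p` (meaningful for `p ≥ 1`). -/
def periodHoles (β : ℝ) (p : ℕ) : Set ℝ :=
  {t | t ∈ Set.Ico (0 : ℝ) 1 ∧ ∃ x ∈ survivorSet β t, Function.minimalPeriod (betaMap β) x = p}

/-- The critical value `S_β(p)`. -/
def criticalValue (β : ℝ) (p : ℕ) : ℝ := sSup (periodHoles β p)

end

/-! Put `r = 1/β`, and let the digit of a point be 0 below `r` and 1 otherwise. Since `1 = r + r² +
r³`, no orbit has digits 111. An orbit staying `≥ r²` has no digits 00 either, so a periodic one is
a cyclic concatenation of the blocks 01 and 011. If it contains 01, it is coded by a list `k₁, …,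
kₙ`, standing for `01(011)^k₁ ⋯ 01(011)^kₙ`, of length `2n + 3∑kᵢ`.

In terms of the gap `e = r - y`, reading a block backwards is affine: 011 gives `e ↦ r³e`, and 01
gives `e ↦ r⁴ + r²e`. A cycle is thus the fixed point `cycleGap` of a contraction of `[0, r]`. Its
gap lies between `r⁴` and `r⁴ + r^(3+3k₁)`, so larger exponents give larger points and lists compare
lexicographically (`cycleGap_lt_of_lt`, `cycleGap_cons_lt_iff`).

The critical value is therefore a max-min problem: among primitive cyclic lists of length `p`,
maximise the least rotation. The number of blocks is fixed modulo 3 by `p`; the optimum has one, two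
or three blocks with exponents as equal as primitivity allows (`isGreatest_single`,
`isGreatest_pair_one` and its companions). For `p = 1, 3, 4, 6` there is no primitive list, so 00
must occur; the optimal words are 0, 001, 0011 and 001101. As `p` grows `k₁` tends to infinity, so
the gap tends to `r⁴` and the limit is `r - r⁴`. -/

/-- The tribonacci number in terms of its inverse `r`. -/
structure IsTribonacci (β r : ℝ) : Prop where
  mul_eq : β * r = 1
  sum_eq : r + r ^ 2 + r ^ 3 = 1
  pos : 0 < r
  gt : 0.5436 < r
  lt : r < 0.5438

theorem isTribonacci_inv {β : ℝ} (h₁ : 1 < β) (hβ : β ^ 3 = β ^ 2 + β + 1) :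
    IsTribonacci β β⁻¹ := by
  have h0 : β ≠ 0 := by positivity
  have hm : β * β⁻¹ = 1 := mul_inv_cancel₀ h0
  have hp : 0 < β⁻¹ := by positivity
  have hs : β⁻¹ + β⁻¹ ^ 2 + β⁻¹ ^ 3 = 1 := by
    field_simp
    linear_combination -hβ
  refine ⟨hm, hs, hp, ?_, ?_⟩
  · by_contra! h
    nlinarith [mul_le_mul h h hp.le (by norm_num), pow_le_pow_left₀ hp.le h 3]
  · by_contra! h
    nlinarith [pow_le_pow_left₀ (by norm_num) h 2, pow_le_pow_left₀ (by norm_num) h 3]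

theorem betaMap_eq_mul {β y : ℝ} (h0 : 0 ≤ β * y) (h1 : β * y < 1) : betaMap β y = β * y :=
  Int.fract_eq_self.2 ⟨h0, h1⟩

theorem betaMap_eq_mul_sub_one {β y : ℝ} (h0 : 1 ≤ β * y) (h1 : β * y < 2) :
    betaMap β y = β * y - 1 := by
  unfold betaMap
  rw [Int.fract_eq_iff]
  exact ⟨by linarith, by linarith, 1, by push_cast; ring⟩

theorem betaMap_mem (β y : ℝ) : betaMap β y ∈ Set.Ico (0 : ℝ) 1 :=
  ⟨Int.fract_nonneg _, Int.fract_lt_one _⟩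

/-! ### Blocks 01 and 011 in the gap coordinate -/

namespace IsTribonacci

variable {β r : ℝ} (h : IsTribonacci β r)
include h

theorem one_lt : 1 < β := by
  have := h.mul_eq; have := h.pos; have := h.lt
  by_contra! hc
  nlinarith

theorem lt_two : β < 2 := by
  have := h.mul_eq; have := h.pos; have := h.gt
  by_contra! hc
  nlinarith

theorem lt_one : r < 1 := by linarith [h.lt]

theorem pow_four : r ^ 4 = r - r ^ 2 - r ^ 3 := by
  linear_combination r * h.sum_eq

theorem pow_four' : r ^ 4 = 2 * r - 1 := by
  linear_combination (r - 1) * h.sum_eq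

/-- One passage through the block `01`. -/
theorem betaMap_short {e : ℝ} (h0 : 0 < e) (h1 : e ≤ r) :
    r ≤ betaMap β (r - (r ^ 4 + r ^ 2 * e)) ∧
      betaMap β (betaMap β (r - (r ^ 4 + r ^ 2 * e))) = r - e := by
  have hr := h.pos
  have h2 := h.lt_two
  have hb := h.one_lt
  have hs := h.sum_eq
  have e1 : β * (r - (r ^ 4 + r ^ 2 * e)) = 1 - r ^ 3 - r * e := by
    linear_combination (1 - r ^ 3 - r * e) * h.mul_eq
  have a1 : r * e ≤ r * r := by gcongr
  have a2 : 0 < r * e := by positivity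
  have a3 : 0 < r ^ 3 := by positivity
  have hT : betaMap β (r - (r ^ 4 + r ^ 2 * e)) = 1 - r ^ 3 - r * e := by
    rw [betaMap_eq_mul] <;> rw [e1] <;> nlinarith
  have e2 : β * (1 - r ^ 3 - r * e) = 1 + r - e := by
    linear_combination (1 + r - e) * h.mul_eq - β * h.sum_eq
  refine ⟨by rw [hT]; nlinarith, ?_⟩
  rw [hT, betaMap_eq_mul_sub_one, e2]
  · ring
  · rw [e2]; linarith
  · rw [e2]; linarith [h.lt_one]

/-- One passage through the block `011`. -/
theorem betaMap_long {e : ℝ} (h0 : 0 < e) (h1 : e ≤ r) :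
    r ≤ betaMap β (r - r ^ 3 * e) ∧ r ≤ betaMap β (betaMap β (r - r ^ 3 * e)) ∧
      betaMap β (betaMap β (betaMap β (r - r ^ 3 * e))) = r - e := by
  have hr := h.pos
  have h2 := h.lt_two
  have hs := h.sum_eq
  have e1 : β * (r - r ^ 3 * e) = 1 - r ^ 2 * e := by
    linear_combination (1 - r ^ 2 * e) * h.mul_eq
  have a1 : r ^ 2 * e ≤ r ^ 2 * r := by gcongr
  have a1' : r * e ≤ r * r := by gcongr
  have a2 : 0 < r * e := by positivity
  have a2' : 0 < r ^ 2 * e := by positivity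
  have a3 : 0 < r ^ 2 := by positivity
  have hT : betaMap β (r - r ^ 3 * e) = 1 - r ^ 2 * e := by
    rw [betaMap_eq_mul] <;> rw [e1] <;> nlinarith
  have e2 : β * (1 - r ^ 2 * e) = 1 + r + r ^ 2 - r * e := by
    linear_combination (1 + r + r ^ 2 - r * e) * h.mul_eq - β * h.sum_eq
  have hT2 : betaMap β (1 - r ^ 2 * e) = r + r ^ 2 - r * e := by
    rw [betaMap_eq_mul_sub_one, e2]
    · ring
    · rw [e2]; nlinarith
    · rw [e2]; nlinarith [h.lt]
  have e3 : β * (r + r ^ 2 - r * e) = 1 + r - e := by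
    linear_combination (1 + r - e) * h.mul_eq
  refine ⟨by rw [hT]; nlinarith, by rw [hT, hT2]; nlinarith, ?_⟩
  rw [hT, hT2, betaMap_eq_mul_sub_one, e3]
  · ring
  · rw [e3]; linarith
  · rw [e3]; linarith [h.lt_one]

/-- `k` passages through the block `011`. -/
theorem iterate_long (k : ℕ) {e : ℝ} (h0 : 0 < e) (h1 : e ≤ r) :
    (betaMap β)^[3 * k] (r - r ^ (3 * k) * e) = r - e ∧
      ∀ j < 3 * k, r - r ^ 4 ≤ (betaMap β)^[j] (r - r ^ (3 * k) * e) := by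
  have hr := h.pos
  have hr4 : 0 < r ^ 4 := by positivity
  induction k with
  | zero => simp
  | succ k ih =>
    have hk : r ^ (3 * k) ≤ 1 := pow_le_one₀ hr.le h.lt_one.le
    have hq : r ^ (3 * k) * e ≤ r := by nlinarith [pow_pos hr (3 * k)]
    have hq0 : 0 < r ^ (3 * k) * e := by positivity
    obtain ⟨b1, b2, b3⟩ := h.betaMap_long hq0 hq
    have hrw : r ^ (3 * (k + 1)) * e = r ^ 3 * (r ^ (3 * k) * e) := by ring
    rw [hrw]
    constructor
    · rw [show 3 * (k + 1) = 3 * k + 3 by ring, Function.iterate_add_apply]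
      simp only [Function.iterate_succ, Function.iterate_zero, Function.comp, id]
      rw [b3, ih.1]
    · intro j hj
      match j with
      -- The start of a block 011 has gap `r³` times a gap at most `r`, hence at most `r⁴`.
      | 0 =>
        have : r ^ 3 * (r ^ (3 * k) * e) ≤ r ^ 3 * r := by gcongr
        simp only [Function.iterate_zero, id]
        nlinarith
      | 1 => simp only [Function.iterate_one]; linarith
      | 2 =>
        simp only [Function.iterate_succ, Function.iterate_zero, Function.comp, id]; linarith
      | j + 3 =>
        rw [Function.iterate_add_apply]
        simp only [Function.iterate_succ, Function.iterate_zero, Function.comp, id]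
        rw [b3]
        exact ih.2 j (by omega)

/-- A passage through the block `01` followed by `k` passages through the block `011`. -/
theorem iterate_block (k : ℕ) {e : ℝ} (h0 : 0 < e) (h1 : e ≤ r) :
    (betaMap β)^[2 + 3 * k] (r - (r ^ 4 + r ^ (2 + 3 * k) * e)) = r - e ∧
      ∀ j, 0 < j → j < 2 + 3 * k →
        r - r ^ 4 ≤ (betaMap β)^[j] (r - (r ^ 4 + r ^ (2 + 3 * k) * e)) := by
  have hr := h.pos
  have hr4 : 0 < r ^ 4 := by positivity
  have hk : r ^ (3 * k) ≤ 1 := pow_le_one₀ hr.le h.lt_one.le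
  have hq : r ^ (3 * k) * e ≤ r := by nlinarith [pow_pos hr (3 * k)]
  have hq0 : 0 < r ^ (3 * k) * e := by positivity
  obtain ⟨b1, b2⟩ := h.betaMap_short hq0 hq
  obtain ⟨c1, c2⟩ := h.iterate_long k h0 h1
  rw [show r ^ (2 + 3 * k) * e = r ^ 2 * (r ^ (3 * k) * e) by ring]
  constructor
  · rw [Nat.add_comm, Function.iterate_add_apply]
    simp only [Function.iterate_succ, Function.iterate_zero, Function.comp, id]
    rw [b2, c1]
  · intro j hj0 hj
    match j with
    | 1 => simp only [Function.iterate_one]; linarith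
    | j + 2 =>
      rw [Function.iterate_add_apply]
      simp only [Function.iterate_succ, Function.iterate_zero, Function.comp, id]
      rw [b2]
      exact c2 j (by omega)

end IsTribonacci

/-! ### Lists of exponents, their cycles and the order between them -/

/-- The length of the binary word `01(011)^k₁ 01(011)^k₂ …` coded by the list `k₁, k₂, …`. -/
def blockLength (l : List ℕ) : ℕ := (l.map (fun k => 2 + 3 * k)).sum

@[simp] theorem blockLength_nil : blockLength [] = 0 := rfl

@[simp] theorem blockLength_cons (k : ℕ) (l : List ℕ) :
    blockLength (k :: l) = 2 + 3 * k + blockLength l := rfl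

/-- The distance to `r` of the point which follows the word coded by `l` and ends at
distance `e` from `r`. -/
noncomputable def blockGap (r : ℝ) : List ℕ → ℝ → ℝ
  | [], e => e
  | k :: l, e => r ^ 4 + r ^ (2 + 3 * k) * blockGap r l e

/-- The distance to `r` of the point whose orbit follows periodically the word coded by `l`. -/
noncomputable def cycleGap (r : ℝ) (l : List ℕ) : ℝ := blockGap r l 0 / (1 - r ^ blockLength l)

theorem blockGap_eq (r : ℝ) (l : List ℕ) (e : ℝ) :
    blockGap r l e = blockGap r l 0 + r ^ blockLength l * e := by
  induction l with
  | nil => simp [blockGap]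
  | cons k l ih => simp only [blockGap, blockLength_cons]; rw [ih]; ring

theorem blockGap_append (r : ℝ) (l l' : List ℕ) (e : ℝ) :
    blockGap r (l ++ l') e = blockGap r l (blockGap r l' e) := by
  induction l with
  | nil => rfl
  | cons k l ih => simp only [List.cons_append, blockGap, ih]

theorem blockLength_pos {l : List ℕ} (hl : l ≠ []) : 0 < blockLength l := by
  cases l with
  | nil => exact absurd rfl hl
  | cons k l => simp only [blockLength_cons]; omega

namespace IsTribonacci

variable {β r : ℝ} (h : IsTribonacci β r)
include h

theorem one_sub_pow_pos {n : ℕ} (hn : 0 < n) : 0 < 1 - r ^ n := by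
  have := pow_lt_one₀ h.pos.le h.lt_one hn.ne'
  linarith

theorem eq_cycleGap {l : List ℕ} (hl : l ≠ []) {e : ℝ} (he : blockGap r l e = e) :
    e = cycleGap r l := by
  have hw := h.one_sub_pow_pos (blockLength_pos hl)
  rw [blockGap_eq] at he
  unfold cycleGap
  rw [eq_div_iff hw.ne']
  linarith

theorem blockGap_cycleGap {l : List ℕ} (hl : l ≠ []) :
    blockGap r l (cycleGap r l) = cycleGap r l := by
  have hw := h.one_sub_pow_pos (blockLength_pos hl)
  rw [blockGap_eq]
  unfold cycleGap
  field_simp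
  ring

/-- Passing the first block carries the fixed point for `k :: l` to the fixed point for the rotated
list `l ++ [k]`. -/
theorem cycleGap_cons (k : ℕ) (l : List ℕ) :
    cycleGap r (k :: l) = r ^ 4 + r ^ (2 + 3 * k) * cycleGap r (l ++ [k]) := by
  have h1 := h.blockGap_cycleGap (l := k :: l) (by simp)
  have h2 : blockGap r l (cycleGap r (k :: l)) = cycleGap r (l ++ [k]) := by
    apply h.eq_cycleGap (by simp)
    rw [blockGap_append]
    congr 1
  rw [← h2]
  exact h1.symm

/-- Each block map preserves `[0, r]` because `r⁴ + r²·r = r - r² ≤ r`. -/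
theorem blockGap_mem (l : List ℕ) {e : ℝ} (h0 : 0 ≤ e) (h1 : e ≤ r) :
    0 ≤ blockGap r l e ∧ blockGap r l e ≤ r := by
  have hr := h.pos
  induction l with
  | nil => exact ⟨h0, h1⟩
  | cons k l ih =>
    simp only [blockGap]
    have a : r ^ (2 + 3 * k) ≤ r ^ 2 := pow_le_pow_of_le_one hr.le h.lt_one.le (by omega)
    have b : r ^ (2 + 3 * k) * blockGap r l e ≤ r ^ 2 * r :=
      mul_le_mul a ih.2 ih.1 (by positivity)
    have c : 0 ≤ r ^ (2 + 3 * k) * blockGap r l e := mul_nonneg (by positivity) ih.1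
    have d : 0 < r ^ 4 := by positivity
    refine ⟨by linarith, ?_⟩
    have := h.pow_four
    nlinarith

theorem cycleGap_le_inv {l : List ℕ} (hl : l ≠ []) : cycleGap r l ≤ r := by
  have hw := h.one_sub_pow_pos (blockLength_pos hl)
  unfold cycleGap
  rw [div_le_iff₀ hw]
  have := (h.blockGap_mem l h.pos.le le_rfl).2
  rw [blockGap_eq] at this
  linarith

theorem cycleGap_nonneg {l : List ℕ} (hl : l ≠ []) : 0 ≤ cycleGap r l :=
  div_nonneg (h.blockGap_mem l le_rfl h.pos.le).1 (h.one_sub_pow_pos (blockLength_pos hl)).le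

theorem lt_cycleGap {l : List ℕ} (hl : l ≠ []) : r ^ 4 < cycleGap r l := by
  have hr := h.pos
  -- Nonnegativity of the rotated gap first gives positivity; using positivity once more makes the
  -- bound `r⁴` strict.
  have key : ∀ {l : List ℕ}, l ≠ [] → 0 < cycleGap r l := by
    intro l hl
    cases l with
    | nil => exact absurd rfl hl
    | cons k l =>
      rw [h.cycleGap_cons]
      have := h.cycleGap_nonneg (l := l ++ [k]) (by simp)
      positivity
  cases l with
  | nil => exact absurd rfl hl
  | cons k l =>
    rw [h.cycleGap_cons]
    have := key (l := l ++ [k]) (by simp)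
    have : 0 < r ^ (2 + 3 * k) * cycleGap r (l ++ [k]) := by positivity
    linarith

theorem cycleGap_pos {l : List ℕ} (hl : l ≠ []) : 0 < cycleGap r l :=
  (pow_pos h.pos 4).trans (h.lt_cycleGap hl)

theorem cycleGap_cons_le (k : ℕ) (l : List ℕ) :
    cycleGap r (k :: l) ≤ r ^ 4 + r ^ (3 + 3 * k) := by
  rw [h.cycleGap_cons, show 3 + 3 * k = (2 + 3 * k) + 1 by ring, pow_succ r (2 + 3 * k)]
  have := h.cycleGap_le_inv (l := l ++ [k]) (by simp)
  have := pow_pos h.pos (2 + 3 * k)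
  gcongr

theorem cycleGap_le {l : List ℕ} (hl : l ≠ []) : cycleGap r l ≤ r - r ^ 2 := by
  cases l with
  | nil => exact absurd rfl hl
  | cons k l =>
    have := h.cycleGap_cons_le k l
    have a : r ^ (3 + 3 * k) ≤ r ^ 3 :=
      pow_le_pow_of_le_one h.pos.le h.lt_one.le (by omega)
    linarith [h.pow_four]

/-- A point with more blocks `011` after the first block `01` is larger. -/
theorem cycleGap_lt_of_lt {k k' : ℕ} (hk : k' < k) (l l' : List ℕ) :
    cycleGap r (k :: l) < cycleGap r (k' :: l') := by
  have hr := h.pos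
  have h1 := h.cycleGap_cons_le k l
  rw [h.cycleGap_cons k' l']
  have h2 := h.lt_cycleGap (l := l' ++ [k']) (by simp)
  -- This is where the orders match: `3 + 3k ≥ 2 + 3k' + 4` as soon as `k ≥ k' + 1`, with equality
  -- when `k = k' + 1`. Strictness comes from the gap of the rotated list exceeding `r⁴`.
  have a : r ^ (3 + 3 * k) ≤ r ^ (2 + 3 * k') * r ^ 4 := by
    rw [← pow_add]
    exact pow_le_pow_of_le_one hr.le h.lt_one.le (by omega)
  have b : r ^ (2 + 3 * k') * r ^ 4 < r ^ (2 + 3 * k') * cycleGap r (l' ++ [k']) := by gcongr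
  linarith

theorem cycleGap_cons_lt_iff {k : ℕ} {l l' : List ℕ} :
    cycleGap r (k :: l) < cycleGap r (k :: l') ↔
      cycleGap r (l ++ [k]) < cycleGap r (l' ++ [k]) := by
  rw [h.cycleGap_cons, h.cycleGap_cons, add_lt_add_iff_left,
    mul_lt_mul_iff_right₀ (pow_pos h.pos _)]

/-- The order of the points is the lexicographic order of the codes. -/
theorem le_of_cycleGap_lt {k k' : ℕ} {l l' : List ℕ}
    (hlt : cycleGap r (k :: l) < cycleGap r (k' :: l')) :
    k' ≤ k ∧ (k = k' → cycleGap r (l ++ [k]) < cycleGap r (l' ++ [k'])) := by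
  constructor
  · by_contra! hc
    exact absurd (h.cycleGap_lt_of_lt hc l' l) hlt.not_gt
  · rintro rfl
    exact h.cycleGap_cons_lt_iff.1 hlt

theorem iterate_cycle (k : ℕ) (l : List ℕ) :
    (betaMap β)^[2 + 3 * k] (r - cycleGap r (k :: l)) = r - cycleGap r (l ++ [k]) ∧
      ∀ j, 0 < j → j < 2 + 3 * k →
        r - r ^ 4 ≤ (betaMap β)^[j] (r - cycleGap r (k :: l)) := by
  rw [h.cycleGap_cons]
  exact h.iterate_block k (h.cycleGap_pos (by simp)) (h.cycleGap_le_inv (by simp))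

/-- If the point coded by `l` is the strict minimum of the points coded by the rotations of `l`,
it is the strict minimum of its orbit. -/
theorem iterate_of_forall_rotate (l l' : List ℕ) {y : ℝ} (hy : y < r - r ^ 4)
    (hrot : ∀ s t, l = s ++ t → s ≠ [] → t ≠ [] → y < r - cycleGap r (t ++ l' ++ s)) :
    (betaMap β)^[blockLength l] (r - cycleGap r (l ++ l')) = r - cycleGap r (l' ++ l) ∧
      ∀ j, 0 < j → j < blockLength l → y < (betaMap β)^[j] (r - cycleGap r (l ++ l')) := by
  induction l generalizing l' with
  | nil => simp
  | cons k l ih =>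
    obtain ⟨a, b⟩ := h.iterate_cycle k (l ++ l')
    have ih' := ih (l' ++ [k]) (by
      intro s t hst hs ht
      have := hrot (k :: s) t (by simp [hst]) (by simp) ht
      simpa using this)
    rw [List.append_assoc] at a
    constructor
    · rw [blockLength_cons, Nat.add_comm, Function.iterate_add_apply, List.cons_append, a,
        ih'.1]
      simp
    · intro j hj0 hj
      rcases lt_trichotomy j (2 + 3 * k) with hlt | heq | hgt
      · exact hy.trans_le (b j hj0 hlt)
      · subst heq
        rw [List.cons_append, a]
        by_cases hl : l = []
        · subst hl; simp at hj
        · simpa using hrot [k] l rfl (by simp) hl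
      · obtain ⟨i, rfl⟩ := Nat.exists_eq_add_of_le' hgt.le
        rw [Function.iterate_add_apply, List.cons_append, a]
        simp only [blockLength_cons] at hj
        exact ih'.2 i (by omega) (by omega)

end IsTribonacci

/-! ### Coding orbits that stay above `r²` -/

namespace IsTribonacci

variable {β r : ℝ} (h : IsTribonacci β r)
include h

/-- The intervals `(r^(3k+4), r^(3k+1)]` tile `(0, r]`. The index `k` counts the blocks 011 read
before the next point with digits 010. -/
theorem exists_pow_mul_gt {e : ℝ} (he0 : 0 < e) (he : e ≤ r) :
    ∃ k : ℕ, e ≤ r ^ (3 * k) * r ∧ r ^ (3 * k) * r ^ 4 < e := by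
  have hr := h.pos
  have hlim : ∃ k : ℕ, r ^ (3 * k) * r ^ 4 < e := by
    obtain ⟨k, hk⟩ := exists_pow_lt_of_lt_one he0 h.lt_one
    refine ⟨k, lt_of_le_of_lt ?_ hk⟩
    rw [← pow_add]
    exact pow_le_pow_of_le_one hr.le h.lt_one.le (by omega)
  classical
  refine ⟨Nat.find hlim, ?_, Nat.find_spec hlim⟩
  rcases hk : Nat.find hlim with _ | k
  · simpa using he
  · have := Nat.find_min hlim (m := k) (by omega)
    rw [not_lt] at this
    calc e ≤ _ := this
      _ = _ := by ring

/-- An orbit which stays `≥ r²` and starts below `r` follows some blocks `011` and then comes to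
a point with digits `010`. -/
theorem exists_short_of_lt_inv {y : ℝ} (h0 : r ^ 2 ≤ y) (h1 : y < r) :
    ∃ n, (betaMap β)^[n] y < r - r ^ 4 := by
  have hr := h.pos
  obtain ⟨k, hk1, hk2⟩ := h.exists_pow_mul_gt (e := r - y) (by linarith) (by nlinarith)
  have hp : 0 < r ^ (3 * k) := by positivity
  set e := (r - y) / r ^ (3 * k) with he
  have hye : y = r - r ^ (3 * k) * e := by rw [he]; field_simp; ring
  have he0 : r ^ 4 < e := by rw [he, lt_div_iff₀ hp]; linarith
  have her : e ≤ r := by rw [he, div_le_iff₀ hp]; linarith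
  refine ⟨3 * k, ?_⟩
  rw [hye, (h.iterate_long k ((pow_pos hr 4).trans he0) her).1]
  linarith

theorem exists_iterate_lt_inv {y : ℝ} (hy : y ∈ Set.Ico (0 : ℝ) 1) :
    ∃ n, (betaMap β)^[n] y < r := by
  have hr := h.pos
  have hb := h.one_lt
  have hm := h.mul_eq
  by_contra! hc
  have step : ∀ z, r ≤ z → z < 1 → betaMap β z = β * z - 1 := fun z hz hz1 =>
    betaMap_eq_mul_sub_one (by nlinarith) (by nlinarith [h.lt_two])
  have h0 := hc 0
  have h1 := hc 1
  have h2 := hc 2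
  simp only [Function.iterate_succ, Function.iterate_zero, Function.comp, id] at h0 h1 h2
  have hT := step y h0 hy.2
  have hT2 := step (betaMap β y) h1 (betaMap_mem _ _).2
  rw [hT2, hT] at h2
  -- With `r = β² - β - 1`, three digits 1 in a row would give `β²y - β - 1 ≥ r`, that is `y ≥ 1`.
  have hs : β * β - β - 1 = r := by
    linear_combination (β + (1 + r) * (β * r + 1)) * h.mul_eq - β ^ 2 * h.sum_eq
  nlinarith [hy.2]

theorem exists_iterate_short {x : ℝ} (hx : x ∈ Set.Ico (0 : ℝ) 1)
    (hge : ∀ n, r ^ 2 ≤ (betaMap β)^[n] x) : ∃ n, (betaMap β)^[n] x < r - r ^ 4 := by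
  obtain ⟨n, hn⟩ := h.exists_iterate_lt_inv hx
  obtain ⟨m, hm⟩ := h.exists_short_of_lt_inv (hge n) hn
  exact ⟨m + n, by rwa [Function.iterate_add_apply]⟩

/-- The code of a piece of orbit between two points with digits `010`. -/
theorem exists_blockGap (n : ℕ) {y : ℝ} (hge : ∀ n, r ^ 2 ≤ (betaMap β)^[n] y)
    (hy : y < r - r ^ 4) (hn : (betaMap β)^[n] y < r - r ^ 4) :
    ∃ l, blockLength l = n ∧ r - y = blockGap r l (r - (betaMap β)^[n] y) := by
  have hr := h.pos
  induction n using Nat.strong_induction_on generalizing y with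
  | _ n ih =>
    rcases Nat.eq_zero_or_pos n with rfl | hn0
    · exact ⟨[], rfl, rfl⟩
    have hr2 : 0 < r ^ 2 := by positivity
    have h0 := hge 0
    simp only [Function.iterate_zero, id] at h0
    -- The quotient is the gap left after the block 01; it is at most `r` because `y ≥ r²`.
    obtain ⟨k, hk1, hk2⟩ := h.exists_pow_mul_gt (e := (r - y - r ^ 4) / r ^ 2)
      (div_pos (by linarith) hr2)
      (by rw [div_le_iff₀ hr2]; nlinarith [h.pow_four])
    have hp : 0 < r ^ (2 + 3 * k) := by positivity
    rw [div_le_iff₀ hr2] at hk1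
    rw [lt_div_iff₀ hr2] at hk2
    set e := (r - y - r ^ 4) / r ^ (2 + 3 * k) with he
    have hye : y = r - (r ^ 4 + r ^ (2 + 3 * k) * e) := by rw [he]; field_simp; ring
    have he0 : r ^ 4 < e := by rw [he, lt_div_iff₀ hp, pow_add]; linarith
    have her : e ≤ r := by rw [he, div_le_iff₀ hp, pow_add]; linarith
    obtain ⟨a, b⟩ := h.iterate_block k ((pow_pos hr 4).trans he0) her
    rw [← hye] at a b
    -- Time `n` cannot fall strictly inside the stripped blocks, where the orbit stays `≥ r - r⁴`.
    have hkn : 2 + 3 * k ≤ n := by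
      by_contra! hc
      exact absurd hn (b n hn0 hc).not_gt
    obtain ⟨i, rfl⟩ := Nat.exists_eq_add_of_le' hkn
    rw [Function.iterate_add_apply, a] at hn
    obtain ⟨l, hl1, hl2⟩ := ih i (by omega) (y := r - e)
      (fun m => by
        rw [← a, ← Function.iterate_add_apply]; exact hge _) (by linarith) hn
    refine ⟨k :: l, by rw [blockLength_cons, hl1, Nat.add_comm], ?_⟩
    rw [blockGap, Function.iterate_add_apply, a, ← hl2]
    linarith

theorem exists_iterate_eq_rotate (s t : List ℕ) :
    ∃ n, (betaMap β)^[n] (r - cycleGap r (s ++ t)) = r - cycleGap r (t ++ s) := by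
  induction s generalizing t with
  | nil => exact ⟨0, by simp⟩
  | cons k s ih =>
    obtain ⟨n, hn⟩ := ih (t ++ [k])
    refine ⟨n + (2 + 3 * k), ?_⟩
    rw [Function.iterate_add_apply, List.cons_append, (h.iterate_cycle k (s ++ t)).1,
      List.append_assoc, hn]
    simp

/-- A periodic orbit which stays `≥ r²` is coded by a list. -/
theorem exists_code {x : ℝ} (hx : x ∈ Set.Ico (0 : ℝ) 1)
    (hp : 0 < Function.minimalPeriod (betaMap β) x) (hge : ∀ n, r ^ 2 ≤ (betaMap β)^[n] x) :
    ∃ l, l ≠ [] ∧ blockLength l = Function.minimalPeriod (betaMap β) x ∧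
      (∀ s t, l = s ++ t → ∃ n, r - cycleGap r (t ++ s) = (betaMap β)^[n] x) ∧
      ∀ n c, l = List.replicate n c → n = 1 := by
  obtain ⟨m, hm⟩ := h.exists_iterate_short hx hge
  set y := (betaMap β)^[m] x with hy
  have hxper : x ∈ Function.periodicPts (betaMap β) := Function.minimalPeriod_pos_iff_mem_periodicPts.1 hp
  have hyp : Function.minimalPeriod (betaMap β) y = Function.minimalPeriod (betaMap β) x :=
    Function.minimalPeriod_apply_iterate hxper m
  have hyper : (betaMap β)^[Function.minimalPeriod (betaMap β) x] y = y := by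
    rw [← hyp]; exact Function.iterate_minimalPeriod
  obtain ⟨l, hl, hl2⟩ := h.exists_blockGap (Function.minimalPeriod (betaMap β) x) (y := y)
    (fun n => by rw [hy, ← Function.iterate_add_apply]; exact hge _) hm (by rw [hyper]; exact hm)
  have hne : l ≠ [] := by rintro rfl; simp at hl; omega
  rw [hyper] at hl2
  have hyl : y = r - cycleGap r l := by
    have := h.eq_cycleGap hne hl2.symm
    linarith
  refine ⟨l, hne, hl, ?_, ?_⟩
  · rintro s t rfl
    obtain ⟨n, hn⟩ := h.exists_iterate_eq_rotate s t
    exact ⟨n + m, by rw [← hn, ← hyl, hy, Function.iterate_add_apply]⟩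
  · rintro n c rfl
    -- A constant list with more than one entry would give the orbit the shorter period `2 + 3c`.
    -- Constant lists are the only imprimitive ones that need excluding below.
    rcases n with _ | n
    · simp at hne
    have hfix : (betaMap β)^[2 + 3 * c] y = y := by
      have := (h.iterate_cycle c (List.replicate n c)).1
      rw [← List.replicate_succ, ← List.replicate_succ', ← hyl] at this
      exact this
    have hd : Function.minimalPeriod (betaMap β) y ∣ 2 + 3 * c :=
      Function.IsPeriodicPt.minimalPeriod_dvd hfix
    rw [hyp, ← hl] at hd
    have := Nat.le_of_dvd (by omega) hd
    simp only [blockLength, List.map_replicate, List.sum_replicate, smul_eq_mul] at this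
    nlinarith

end IsTribonacci

/-! ### From strict minima of cycles to greatest holes -/

/-- A periodic point which is the strict minimum of its orbit gives a hole. -/
theorem mem_periodHoles_of_forall_lt {β x : ℝ} {p : ℕ} (hp : 0 < p) (hx : x ∈ Set.Ico (0 : ℝ) 1)
    (hper : (betaMap β)^[p] x = x) (hlt : ∀ j, 0 < j → j < p → x < (betaMap β)^[j] x) :
    x ∈ periodHoles β p := by
  have hP : Function.IsPeriodicPt (betaMap β) p x := hper
  refine ⟨hx, x, ⟨hx, fun n => ?_⟩, ?_⟩
  · rw [← hP.iterate_mod_apply n]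
    rcases Nat.eq_zero_or_pos (n % p) with h0 | h0
    · rw [h0]; rfl
    · exact (hlt _ h0 (Nat.mod_lt _ hp)).le
  · have hpos := hP.minimalPeriod_pos hp
    refine le_antisymm (hP.minimalPeriod_le hp) ?_
    by_contra! hc
    have := hlt _ hpos hc
    rw [Function.iterate_minimalPeriod] at this
    exact lt_irrefl _ this

/-- The form in which the critical values are found. -/
theorem isGreatest_periodHoles {β v : ℝ} {p : ℕ} (hp : 0 < p) (hv : v ∈ Set.Ico (0 : ℝ) 1)
    (hper : (betaMap β)^[p] v = v) (hlt : ∀ j, 0 < j → j < p → v < (betaMap β)^[j] v)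
    (hmax : ∀ x ∈ Set.Ico (0 : ℝ) 1, Function.minimalPeriod (betaMap β) x = p →
      (∀ n, v < (betaMap β)^[n] x) → False) :
    IsGreatest (periodHoles β p) v := by
  refine ⟨mem_periodHoles_of_forall_lt hp hv hper hlt, ?_⟩
  rintro t ⟨-, x, ⟨hx, hxt⟩, hxp⟩
  by_contra! hc
  exact hmax x hx hxp fun n => hc.trans_le (hxt n)

namespace IsTribonacci

variable {β r : ℝ} (h : IsTribonacci β r)
include h

theorem isGreatest_cycle {w : List ℕ} (hw : w ≠ [])
    (hrot : ∀ s t, w = s ++ t → s ≠ [] → t ≠ [] → cycleGap r (t ++ s) < cycleGap r w)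
    (hmax : ∀ l, l ≠ [] → blockLength l = blockLength w →
      (∀ s t, l = s ++ t → cycleGap r (t ++ s) < cycleGap r w) →
      (∀ n c, l = List.replicate n c → n = 1) → False) :
    IsGreatest (periodHoles β (blockLength w)) (r - cycleGap r w) := by
  have hr := h.pos
  have h1 := h.lt_cycleGap hw
  have h2 := h.cycleGap_le hw
  have hlt := h.iterate_of_forall_rotate w [] (y := r - cycleGap r w) (by linarith)
    (fun s t hst hs ht => by
      have := hrot s t hst hs ht
      simpa using this)
  simp only [List.append_nil, List.nil_append] at hlt
  have hr2 : 0 < r ^ 2 := by positivity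
  have hr4 : 0 < r ^ 4 := by positivity
  refine isGreatest_periodHoles (blockLength_pos hw) ⟨by linarith, by linarith [h.lt_one]⟩
    hlt.1 hlt.2 fun x hx hxp hxv => ?_
  -- A competing orbit lies above `r - cycleGap r w ≥ r²`, so it too has a code.
  obtain ⟨l, hl, hlw, hlr, hlc⟩ := h.exists_code hx (by rw [hxp]; exact blockLength_pos hw)
    (fun n => by linarith [hxv n])
  refine hmax l hl (hlw.trans hxp) (fun s t hst => ?_) hlc
  obtain ⟨n, hn⟩ := hlr s t hst
  have := hxv n
  linarith

end IsTribonacci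

/-! ### Optimal lists with one, two or three blocks -/

theorem eq_of_append_eq_pair {a b : ℕ} {s t : List ℕ} (h : [a, b] = s ++ t) (hs : s ≠ [])
    (ht : t ≠ []) : s = [a] ∧ t = [b] := by
  rcases s with _ | ⟨x, _ | ⟨y, s⟩⟩ <;> simp_all

theorem eq_of_append_eq_triple {a b c : ℕ} {s t : List ℕ} (h : [a, b, c] = s ++ t) (hs : s ≠ [])
    (ht : t ≠ []) : s = [a] ∧ t = [b, c] ∨ s = [a, b] ∧ t = [c] := by
  rcases s with _ | ⟨x, _ | ⟨y, _ | ⟨z, s⟩⟩⟩ <;> simp_all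

namespace IsTribonacci

variable {β r : ℝ} (h : IsTribonacci β r)
include h

theorem le_of_mem {c : ℕ} {w l : List ℕ}
    (hl : ∀ s t, l = s ++ t → cycleGap r (t ++ s) < cycleGap r (c :: w)) :
    ∀ k ∈ l, c ≤ k := by
  intro k hk
  obtain ⟨s, t, rfl⟩ := List.append_of_mem hk
  exact (h.le_of_cycleGap_lt (hl s (k :: t) rfl)).1

/-- The next exponent after a smallest one. -/
theorem le_next {c d : ℕ} {w l : List ℕ}
    (hl : ∀ s t, l = s ++ t → cycleGap r (t ++ s) < cycleGap r (c :: d :: w))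
    {s t : List ℕ} {k : ℕ} (hst : l = s ++ c :: k :: t) : d ≤ k :=
  (h.le_of_cycleGap_lt ((h.le_of_cycleGap_lt (hl s (c :: k :: t) hst)).2 rfl)).1

/-- The same comparison across the cyclic wrap: the first exponent follows the last one. -/
theorem le_first {c d : ℕ} {w l : List ℕ}
    (hl : ∀ s t, l = s ++ t → cycleGap r (t ++ s) < cycleGap r (c :: d :: w))
    {s : List ℕ} {k : ℕ} (hst : l = k :: s ++ [c]) : d ≤ k :=
  (h.le_of_cycleGap_lt ((h.le_of_cycleGap_lt (hl (k :: s) [c] hst)).2 rfl)).1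

theorem isGreatest_single (m : ℕ) :
    IsGreatest (periodHoles β (3 * m + 2)) (r - cycleGap r [m]) := by
  have key := h.isGreatest_cycle (w := [m]) (by simp) ?_ ?_
  · simpa [Nat.add_comm] using key
  · intro s t hst hs ht
    rcases s with _ | ⟨x, s⟩ <;> simp_all
  · intro l hl hw hr hc
    have hm := h.le_of_mem hr
    rcases l with _ | ⟨a, _ | ⟨b, l⟩⟩
    · exact hl rfl
    · simp only [blockLength_cons, blockLength_nil] at hw
      obtain rfl : a = m := by omega
      exact lt_irrefl _ (hr [] [a] rfl)
    · simp only [blockLength_cons, blockLength_nil] at hw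
      have := hm a (by simp)
      omega

/-- All exponents of a competitor are `≥ w`. Its length modulo 3 forces 2, 5, … blocks, and five are
already too long, so two exponents with sum `2w + 1` remain. -/
theorem isGreatest_pair_one (w : ℕ) :
    IsGreatest (periodHoles β (6 * w + 7)) (r - cycleGap r [w, w + 1]) := by
  have key := h.isGreatest_cycle (w := [w, w + 1]) (by simp) ?_ ?_
  · convert key using 2
    simp; ring
  · intro s t hst hs ht
    obtain ⟨rfl, rfl⟩ := eq_of_append_eq_pair hst hs ht
    exact h.cycleGap_lt_of_lt (Nat.lt_succ_self w) _ _
  · intro l hl hw hr hc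
    have hm := h.le_of_mem hr
    rcases l with _ | ⟨a, _ | ⟨b, _ | ⟨c, _ | ⟨d, _ | ⟨e, l⟩⟩⟩⟩⟩ <;>
      simp only [blockLength_cons, blockLength_nil, List.forall_mem_cons] at hw hm
    · exact hl rfl
    · omega
    · rcases Nat.eq_or_lt_of_le hm.1 with ha | ha
      · obtain rfl := ha
        obtain rfl : b = w + 1 := by omega
        exact lt_irrefl _ (hr [] _ rfl)
      · obtain rfl : b = w := by omega
        obtain rfl : a = b + 1 := by omega
        exact lt_irrefl _ (hr [b + 1] [b] rfl)
    · omega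
    · omega
    · omega

theorem isGreatest_pair_two (w : ℕ) :
    IsGreatest (periodHoles β (6 * w + 10)) (r - cycleGap r [w, w + 2]) := by
  have key := h.isGreatest_cycle (w := [w, w + 2]) (by simp) ?_ ?_
  · convert key using 2
    simp; ring
  · intro s t hst hs ht
    obtain ⟨rfl, rfl⟩ := eq_of_append_eq_pair hst hs ht
    exact h.cycleGap_lt_of_lt (by omega) _ _
  · intro l hl hw hr hc
    have hm := h.le_of_mem hr
    rcases l with _ | ⟨a, _ | ⟨b, _ | ⟨c, _ | ⟨d, _ | ⟨e, l⟩⟩⟩⟩⟩ <;>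
      simp only [blockLength_cons, blockLength_nil, List.forall_mem_cons] at hw hm
    · exact hl rfl
    · omega
    · rcases Nat.eq_or_lt_of_le hm.1 with ha | ha
      · obtain rfl := ha
        obtain rfl : b = w + 2 := by omega
        exact lt_irrefl _ (hr [] _ rfl)
      · rcases Nat.eq_or_lt_of_le hm.2.1 with hb | hb
        · obtain rfl := hb
          obtain rfl : a = w + 2 := by omega
          exact lt_irrefl _ (hr [w + 2] [w] rfl)
        -- The balanced list `[w+1, w+1]` would be better but is not primitive; this is why the
        -- optimum is `[w, w+2]`.
        · obtain rfl : a = w + 1 := by omega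
          obtain rfl : b = w + 1 := by omega
          exact absurd (hc 2 (w + 1) rfl) (by norm_num)
    · omega
    · omega
    -- Five blocks fit only when `w = 0`, and then the word is `(01)^5`.
    · rcases l with _ | ⟨f, l⟩
      · simp only [blockLength_nil] at hw
        obtain ⟨rfl, rfl, rfl, rfl, rfl⟩ : a = 0 ∧ b = 0 ∧ c = 0 ∧ d = 0 ∧ e = 0 := by omega
        exact absurd (hc 5 0 rfl) (by norm_num)
      · simp only [blockLength_cons] at hw
        omega

theorem isGreatest_triple_one (w : ℕ) :
    IsGreatest (periodHoles β (9 * w + 9)) (r - cycleGap r [w, w, w + 1]) := by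
  have key := h.isGreatest_cycle (w := [w, w, w + 1]) (by simp) ?_ ?_
  · convert key using 2
    simp; ring
  · intro s t hst hs ht
    obtain ⟨rfl, rfl⟩ | ⟨rfl, rfl⟩ := eq_of_append_eq_triple hst hs ht
    · exact h.cycleGap_cons_lt_iff.2 (h.cycleGap_lt_of_lt (by omega) _ _)
    · exact h.cycleGap_lt_of_lt (by omega) _ _
  · intro l hl hw hr hc
    have hm := h.le_of_mem hr
    rcases l with _ | ⟨a, _ | ⟨b, _ | ⟨c, _ | ⟨d, _ | ⟨e, _ | ⟨f, l⟩⟩⟩⟩⟩⟩ <;>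
      simp only [blockLength_cons, blockLength_nil, List.forall_mem_cons] at hw hm
    · exact hl rfl
    · omega
    · omega
    · obtain ⟨rfl, rfl, rfl⟩ | ⟨rfl, rfl, rfl⟩ | ⟨rfl, rfl, rfl⟩ :
          (a = w ∧ b = w ∧ c = w + 1) ∨ (a = w ∧ c = w ∧ b = w + 1) ∨
          (b = w ∧ c = w ∧ a = w + 1) := by omega
      · exact lt_irrefl _ (hr [] _ rfl)
      · exact lt_irrefl _ (hr [_, _] [_] rfl)
      · exact lt_irrefl _ (hr [_] [_, _] rfl)
    all_goals omega

theorem isGreatest_triple_two (w : ℕ) :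
    IsGreatest (periodHoles β (9 * w + 12)) (r - cycleGap r [w, w + 1, w + 1]) := by
  have key := h.isGreatest_cycle (w := [w, w + 1, w + 1]) (by simp) ?_ ?_
  · convert key using 2
    simp; ring
  · intro s t hst hs ht
    obtain ⟨rfl, rfl⟩ | ⟨rfl, rfl⟩ := eq_of_append_eq_triple hst hs ht
    · exact h.cycleGap_lt_of_lt (by omega) _ _
    · exact h.cycleGap_lt_of_lt (by omega) _ _
  · intro l hl hw hr hc
    have hm := h.le_of_mem hr
    rcases l with _ | ⟨a, _ | ⟨b, _ | ⟨c, _ | ⟨d, _ | ⟨e, _ | ⟨f, l⟩⟩⟩⟩⟩⟩ <;>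
      simp only [blockLength_cons, blockLength_nil, List.forall_mem_cons] at hw hm
    · exact hl rfl
    · omega
    · omega
    -- The exponents sum to `3w + 2`. Arrangements of `w, w, w+2` are ruled out because each `w`
    -- must be followed cyclically by at least `w + 1`.
    · have h1 : a = w → w + 1 ≤ b := by rintro rfl; exact h.le_next hr (s := []) rfl
      have h2 : b = w → w + 1 ≤ c := by rintro rfl; exact h.le_next hr (s := [_]) rfl
      have h3 : c = w → w + 1 ≤ a := by rintro rfl; exact h.le_first hr (s := [_]) rfl
      obtain ⟨rfl, rfl, rfl⟩ | ⟨rfl, rfl, rfl⟩ | ⟨rfl, rfl, rfl⟩ :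
          (a = w ∧ b = w + 1 ∧ c = w + 1) ∨ (b = w ∧ a = w + 1 ∧ c = w + 1) ∨
          (c = w ∧ a = w + 1 ∧ b = w + 1) := by omega
      · exact lt_irrefl _ (hr [] _ rfl)
      · exact lt_irrefl _ (hr [_] [_, _] rfl)
      · exact lt_irrefl _ (hr [_, _] [_] rfl)
    · omega
    · omega
    · rcases l with _ | ⟨g, l⟩
      · simp only [blockLength_nil] at hw
        obtain ⟨rfl, rfl, rfl, rfl, rfl, rfl⟩ :
          a = 0 ∧ b = 0 ∧ c = 0 ∧ d = 0 ∧ e = 0 ∧ f = 0 := by omega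
        exact absurd (hc 6 0 rfl) (by norm_num)
      · simp only [blockLength_cons] at hw
        omega

theorem isGreatest_triple_three (w : ℕ) :
    IsGreatest (periodHoles β (9 * w + 15)) (r - cycleGap r [w, w + 2, w + 1]) := by
  have key := h.isGreatest_cycle (w := [w, w + 2, w + 1]) (by simp) ?_ ?_
  · convert key using 2
    simp; ring
  · intro s t hst hs ht
    obtain ⟨rfl, rfl⟩ | ⟨rfl, rfl⟩ := eq_of_append_eq_triple hst hs ht
    · exact h.cycleGap_lt_of_lt (by omega) _ _
    · exact h.cycleGap_lt_of_lt (by omega) _ _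
  · intro l hl hw hr hc
    have hm := h.le_of_mem hr
    rcases l with _ | ⟨a, _ | ⟨b, _ | ⟨c, _ | ⟨d, _ | ⟨e, _ | ⟨f, l⟩⟩⟩⟩⟩⟩ <;>
      simp only [blockLength_cons, blockLength_nil, List.forall_mem_cons] at hw hm
    · exact hl rfl
    · omega
    · omega
    -- The exponents sum to `3w + 3`. Each `w` must be followed by at least `w + 2`, which leaves
    -- the rotations of `[w, w+2, w+1]` and the imprimitive `[w+1, w+1, w+1]`.
    · have h1 : a = w → w + 2 ≤ b := by rintro rfl; exact h.le_next hr (s := []) rfl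
      have h2 : b = w → w + 2 ≤ c := by rintro rfl; exact h.le_next hr (s := [_]) rfl
      have h3 : c = w → w + 2 ≤ a := by rintro rfl; exact h.le_first hr (s := [_]) rfl
      obtain ⟨rfl, rfl, rfl⟩ | ⟨rfl, rfl, rfl⟩ | ⟨rfl, rfl, rfl⟩ | ⟨rfl, rfl, rfl⟩ :
          (a = w ∧ b = w + 2 ∧ c = w + 1) ∨ (b = w ∧ c = w + 2 ∧ a = w + 1) ∨
          (c = w ∧ a = w + 2 ∧ b = w + 1) ∨ (a = w + 1 ∧ b = w + 1 ∧ c = w + 1) := by omega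
      · exact lt_irrefl _ (hr [] _ rfl)
      · exact lt_irrefl _ (hr [_] [_, _] rfl)
      · exact lt_irrefl _ (hr [_, _] [_] rfl)
      · exact absurd (hc 3 (w + 1) rfl) (by norm_num)
    · omega
    · omega
    -- Six blocks force `w = 0` and exponent sum 1, so one of the first two exponents is a 0 not
    -- followed by at least 2.
    · have h1 : a = w → w + 2 ≤ b := by rintro rfl; exact h.le_next hr (s := []) rfl
      have h2 : b = w → w + 2 ≤ c := by rintro rfl; exact h.le_next hr (s := [_]) rfl
      omega

end IsTribonacci

/-! ### The exceptional periods 1, 3, 4 and 6 -/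

namespace IsTribonacci

variable {β r : ℝ} (h : IsTribonacci β r)
include h

theorem pow_three_eq : β ^ 3 = β ^ 2 + β + 1 := by
  linear_combination (β ^ 2 + (β + β * (β * r)) + (1 + β * r + (β * r) ^ 2)) * h.mul_eq -
    β ^ 3 * h.sum_eq

theorem sq_mul_sq : β ^ 2 * r ^ 2 = 1 := by
  linear_combination (β * r + 1) * h.mul_eq

theorem inv_eq : r = β ^ 2 - β - 1 := by
  linear_combination (-(β + (1 + r) * (β * r + 1))) * h.mul_eq + β ^ 2 * h.sum_eq

theorem base_gt : 1.8388 < β := by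
  have := h.mul_eq; have := h.pos; have := h.lt
  by_contra! hc
  nlinarith

theorem base_lt : β < 1.8397 := by
  have := h.mul_eq; have := h.pos; have := h.gt
  by_contra! hc
  nlinarith

theorem betaMap_cases {z : ℝ} (hz : z ∈ Set.Ico (0 : ℝ) 1) :
    betaMap β z = β * z ∧ β * z < 1 ∨ betaMap β z = β * z - 1 ∧ 1 ≤ β * z := by
  have hb := h.one_lt
  have h2 := h.lt_two
  rcases lt_or_ge (β * z) 1 with hlt | hge
  · exact Or.inl ⟨betaMap_eq_mul (mul_nonneg (by linarith) hz.1) hlt, hlt⟩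
  · exact Or.inr ⟨betaMap_eq_mul_sub_one hge (by nlinarith [hz.2]), hge⟩

/-- The only other candidate for a fixed point, `1/(β - 1)`, exceeds 1. -/
theorem isGreatest_one : IsGreatest (periodHoles β 1) 0 := by
  refine isGreatest_periodHoles one_pos ⟨le_rfl, one_pos⟩ (by simp [betaMap])
    (fun j h0 h1 => by omega) fun x hx hp hlt => ?_
  have h0 := hlt 0
  have hfix : betaMap β x = x := Function.minimalPeriod_eq_one_iff_isFixedPt.1 hp
  have hb := h.one_lt
  have h2 := h.lt_two
  have hx1 := hx.2
  simp only [Function.iterate_zero, id] at h0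
  rcases h.betaMap_cases hx with ⟨h1, -⟩ | ⟨h1, -⟩
  · nlinarith
  · nlinarith

/-- Points with digits `0 0 …`. -/
theorem betaMap_zero_zero {y : ℝ} (h0 : 0 ≤ y) (h1 : y < r ^ 2) :
    betaMap β y = β * y ∧ betaMap β (β * y) = β ^ 2 * y := by
  have hb := h.one_lt
  have hq := h.sq_mul_sq
  have h3 : β ^ 2 * y < 1 := by nlinarith
  have hb0 : 0 ≤ β * y := by positivity
  have hb2 : β * y ≤ β ^ 2 * y := by nlinarith
  refine ⟨betaMap_eq_mul hb0 (by linarith), ?_⟩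
  rw [betaMap_eq_mul] <;> rw [← mul_assoc, ← pow_two]
  · positivity
  · exact h3

/-- A periodic orbit not coded by a list has a point with digits `0 0 …`. -/
theorem isGreatest_of_zero_zero {v : ℝ} {p : ℕ} (hp : 0 < p) (hv : v ∈ Set.Ico (0 : ℝ) 1)
    (hper : (betaMap β)^[p] v = v) (hlt : ∀ j, 0 < j → j < p → v < (betaMap β)^[j] v)
    (hcode : ∀ l, l ≠ [] → blockLength l = p → (∀ n c, l = List.replicate n c → n = 1) → False)
    (hmax : ∀ y, y < r ^ 2 → v < y → (betaMap β)^[p] y = y → False) :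
    IsGreatest (periodHoles β p) v := by
  refine isGreatest_periodHoles hp hv hper hlt fun x hx hxp hxv => ?_
  by_cases hge : ∀ n, r ^ 2 ≤ (betaMap β)^[n] x
  · obtain ⟨l, h1, h2, -, h3⟩ := h.exists_code hx (by rw [hxp]; exact hp) hge
    exact hcode l h1 (h2.trans hxp) h3
  · push Not at hge
    obtain ⟨n, hn⟩ := hge
    refine hmax _ hn (hxv n) ?_
    rw [← Function.iterate_add_apply, Nat.add_comm, Function.iterate_add_apply, ← hxp,
      Function.iterate_minimalPeriod]

theorem isGreatest_three : IsGreatest (periodHoles β 3) (1 / (β ^ 3 - 1)) := by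
  have hb := h.base_gt
  have hb' := h.base_lt
  have h3 := h.pow_three_eq
  have hd : 0 < β ^ 3 - 1 := by nlinarith
  set v := 1 / (β ^ 3 - 1) with hv
  have hvd : v * (β ^ 3 - 1) = 1 := by rw [hv]; field_simp
  have hv0 : 0 < v := by positivity
  have hr2 := h.sq_mul_sq
  have hr0 := pow_pos h.pos 2
  have hbv : v < β * v := by nlinarith
  have hbv2 : β * v < β ^ 2 * v := by nlinarith
  have hv1 : β ^ 2 * v < 1 := by nlinarith
  have hvr : v < r ^ 2 := by
    by_contra! hc
    nlinarith [pow_pos (show (0:ℝ) < β by linarith) 2]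
  obtain ⟨t1, t2⟩ := h.betaMap_zero_zero hv0.le hvr
  have t3 : betaMap β (β ^ 2 * v) = v := by
    rw [betaMap_eq_mul_sub_one] <;> nlinarith
  refine h.isGreatest_of_zero_zero (by norm_num) ⟨hv0.le, by linarith⟩ ?_ ?_ ?_ ?_
  · simp only [Function.iterate_succ, Function.iterate_zero, Function.comp, id, t1, t2, t3]
  · intro j h0 hj
    interval_cases j <;>
      simp only [Function.iterate_succ, Function.iterate_zero, Function.comp, id, t1, t2] <;>
      linarith
  · intro l hl hw hc
    rcases l with _ | ⟨a, _ | ⟨b, l⟩⟩ <;> simp only [blockLength_cons, blockLength_nil] at hw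
    all_goals omega
  · intro y hy hvy hper
    obtain ⟨s1, s2⟩ := h.betaMap_zero_zero (hv0.trans hvy).le hy
    simp only [Function.iterate_succ, Function.iterate_zero, Function.comp, id, s1, s2] at hper
    have hm : β ^ 2 * y ∈ Set.Ico (0 : ℝ) 1 := by rw [← s2]; exact betaMap_mem _ _
    -- Digits 001 give back `y = v` and digits 000 give `y = 0`; both contradict `v < y`.
    rcases h.betaMap_cases hm with ⟨e, -⟩ | ⟨e, -⟩ <;> rw [e] at hper <;> nlinarith

theorem isGreatest_four : IsGreatest (periodHoles β 4) ((1 + β) / (β ^ 4 - 1)) := by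
  have hb := h.base_gt
  have hb' := h.base_lt
  have h3 := h.pow_three_eq
  have h4 : β ^ 4 = 2 * β ^ 2 + 2 * β + 1 := by linear_combination (β + 1) * h3
  have hd : 0 < β ^ 4 - 1 := by nlinarith
  set v := (1 + β) / (β ^ 4 - 1) with hv
  have hvd : v * (β ^ 4 - 1) = 1 + β := by rw [hv]; field_simp
  -- Since `β⁴ - 1 = 2β(1 + β)`, the value is simply `v = r/2`.
  have hvb : 2 * (β * v) = 1 := by
    rw [h4] at hvd
    have : (1 + β) * (2 * (β * v) - 1) = 0 := by linear_combination hvd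
    rcases mul_eq_zero.1 this with h5 | h5 <;> linarith
  have hv0 : 0 < v := by positivity
  have hr2 := h.sq_mul_sq
  have hr0 := pow_pos h.pos 2
  have hv1 : β ^ 2 * v = β / 2 := by linear_combination (β / 2) * hvb
  have hv2 : β ^ 3 * v = β ^ 2 / 2 := by linear_combination (β ^ 2 / 2) * hvb
  have hbv : v < β * v := by nlinarith
  have hvr : v < r ^ 2 := by
    by_contra! hc
    nlinarith [pow_pos (show (0:ℝ) < β by linarith) 2]
  obtain ⟨t1, t2⟩ := h.betaMap_zero_zero hv0.le hvr
  have t3 : betaMap β (β ^ 2 * v) = β ^ 3 * v - 1 := by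
    rw [betaMap_eq_mul_sub_one] <;> nlinarith
  have t4 : betaMap β (β ^ 3 * v - 1) = v := by
    rw [betaMap_eq_mul_sub_one] <;> nlinarith
  refine h.isGreatest_of_zero_zero (by norm_num) ⟨hv0.le, by linarith⟩ ?_ ?_ ?_ ?_
  · simp only [Function.iterate_succ, Function.iterate_zero, Function.comp, id, t1, t2, t3, t4]
  · intro j h0 hj
    interval_cases j <;>
      simp only [Function.iterate_succ, Function.iterate_zero, Function.comp, id, t1, t2, t3] <;>
      nlinarith
  · intro l hl hw hc
    rcases l with _ | ⟨a, _ | ⟨b, _ | ⟨c, l⟩⟩⟩ <;>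
      simp only [blockLength_cons, blockLength_nil] at hw
    · exact hl rfl
    · omega
    · obtain ⟨rfl, rfl⟩ : a = 0 ∧ b = 0 := by omega
      exact absurd (hc 2 0 rfl) (by norm_num)
    · omega
  · intro y hy hvy hper
    obtain ⟨s1, s2⟩ := h.betaMap_zero_zero (hv0.trans hvy).le hy
    simp only [Function.iterate_succ, Function.iterate_zero, Function.comp, id, s1, s2] at hper
    have hm : β ^ 2 * y ∈ Set.Ico (0 : ℝ) 1 := by rw [← s2]; exact betaMap_mem _ _
    have g : β ^ 3 * v < β ^ 3 * y := by gcongr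
    rcases h.betaMap_cases hm with ⟨e, e'⟩ | ⟨e, -⟩ <;> rw [e] at hper
    · nlinarith
    · have hm' : β * (β ^ 2 * y) - 1 ∈ Set.Ico (0 : ℝ) 1 := by rw [← e]; exact betaMap_mem _ _
      have g : (β ^ 4 - 1) * v < (β ^ 4 - 1) * y := by gcongr
      rcases h.betaMap_cases hm' with ⟨e, -⟩ | ⟨e, -⟩ <;> rw [e] at hper <;> nlinarith

theorem isGreatest_six :
    IsGreatest (periodHoles β 6) ((1 + β ^ 2 + β ^ 3) / (β ^ 6 - 1)) := by
  have hb := h.base_gt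
  have hb' := h.base_lt
  have hb0 : 0 < β := by linarith
  have h3 := h.pow_three_eq
  have h4 : β ^ 4 = 2 * β ^ 2 + 2 * β + 1 := by linear_combination (β + 1) * h3
  have h5 : β ^ 5 = 4 * β ^ 2 + 3 * β + 2 := by linear_combination (β ^ 2 + β + 2) * h3
  have h6 : β ^ 6 = 7 * β ^ 2 + 6 * β + 4 := by linear_combination (β ^ 3 + β ^ 2 + 2 * β + 4) * h3
  have q1 : 3.381 < β ^ 2 := by nlinarith
  have q2 : β ^ 2 < 3.385 := by nlinarith
  have hd : 0 < β ^ 6 - 1 := by nlinarith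
  set v := (1 + β ^ 2 + β ^ 3) / (β ^ 6 - 1) with hv
  have hvd : v * (β ^ 6 - 1) = 1 + β ^ 2 + β ^ 3 := by rw [hv]; field_simp
  have hv0 : 0 < v := by positivity
  have v1 : 0.27 < v := by rw [hv, lt_div_iff₀ hd, h6, h3]; linarith
  have v2 : v < 0.285 := by rw [hv, div_lt_iff₀ hd, h6, h3]; linarith
  have hr2 := h.sq_mul_sq
  have hr0 := pow_pos h.pos 2
  have hvr : v < r ^ 2 := by nlinarith [h.gt]
  -- `v > r³ + r⁴`
  have v3 : β + 1 < β ^ 4 * v := by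
    have : (β + 1) * (β ^ 6 - 1) < β ^ 4 * (1 + β ^ 2 + β ^ 3) := by
      have : β ^ 4 * (1 + β ^ 2 + β ^ 3) - (β + 1) * (β ^ 6 - 1) = β ^ 4 + β + 1 := by ring
      linarith [pow_pos hb0 4]
    rw [hv, mul_div_assoc', lt_div_iff₀ hd]
    exact this
  have v4 : β ^ 4 * v < β + 1 + r := by
    have : β ^ 4 * v < β ^ 4 * r ^ 2 := by gcongr
    have e : β ^ 4 * r ^ 2 = β ^ 2 := by linear_combination β ^ 2 * hr2
    rw [h.inv_eq]; linarith
  have v5 : 1 < β ^ 3 * v := by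
    have : 6.2 * v ≤ β ^ 3 * v := by gcongr; linarith
    linarith
  obtain ⟨t1, t2⟩ := h.betaMap_zero_zero hv0.le hvr
  have hm2 : β ^ 2 * v ∈ Set.Ico (0 : ℝ) 1 := by rw [← t2]; exact betaMap_mem _ _
  have t3 : betaMap β (β ^ 2 * v) = β ^ 3 * v - 1 := by
    have e0 : β * (β ^ 2 * v) = β ^ 3 * v := by ring
    rcases h.betaMap_cases hm2 with ⟨e, e'⟩ | ⟨e, -⟩
    · linarith
    · linarith
  have hm3 : β ^ 3 * v - 1 ∈ Set.Ico (0 : ℝ) 1 := by rw [← t3]; exact betaMap_mem _ _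
  have t4 : betaMap β (β ^ 3 * v - 1) = β ^ 4 * v - β - 1 := by
    have e0 : β * (β ^ 3 * v - 1) = β ^ 4 * v - β := by ring
    rcases h.betaMap_cases hm3 with ⟨e, e'⟩ | ⟨e, -⟩
    · linarith
    · linarith
  have hm4 : β ^ 4 * v - β - 1 ∈ Set.Ico (0 : ℝ) 1 := by rw [← t4]; exact betaMap_mem _ _
  have t5 : betaMap β (β ^ 4 * v - β - 1) = β ^ 5 * v - β ^ 2 - β := by
    have e0 : β * (β ^ 4 * v - β - 1) = β ^ 5 * v - β ^ 2 - β := by ring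
    have e1 : β * (β ^ 4 * v - β - 1) < β * r := by gcongr; linarith
    rw [h.mul_eq] at e1
    rcases h.betaMap_cases hm4 with ⟨e, -⟩ | ⟨e, e'⟩
    · linarith
    · linarith
  have hm5 : β ^ 5 * v - β ^ 2 - β ∈ Set.Ico (0 : ℝ) 1 := by rw [← t5]; exact betaMap_mem _ _
  have e6 : β * (β ^ 5 * v - β ^ 2 - β) = 1 + v := by linear_combination hvd
  have t6 : betaMap β (β ^ 5 * v - β ^ 2 - β) = v := by
    rw [betaMap_eq_mul_sub_one] <;> rw [e6] <;> linarith
  refine h.isGreatest_of_zero_zero (by norm_num) ⟨hv0.le, by linarith⟩ ?_ ?_ ?_ ?_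
  · simp only [Function.iterate_succ, Function.iterate_zero, Function.comp, id, t1, t2, t3, t4, t5,
      t6]
  · have b1 : v < β * v := by nlinarith
    have b2 : β * v < β ^ 2 * v := by nlinarith
    have bv : β * v < 1.84 * v := by gcongr; linarith
    have b5 : v < β ^ 5 * v - β ^ 2 - β := by
      refine lt_of_mul_lt_mul_left ?_ hb0.le
      rw [e6]; linarith
    have b5' : 0.6 < β ^ 5 * v - β ^ 2 - β := by
      refine lt_of_mul_lt_mul_left ?_ hb0.le
      rw [e6]; linarith
    have b4 : v < β ^ 4 * v - β - 1 := by
      refine lt_of_mul_lt_mul_left ?_ hb0.le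
      have : β * (β ^ 4 * v - β - 1) = β ^ 5 * v - β ^ 2 - β := by ring
      rw [this]; linarith
    have b3 : v < β ^ 3 * v - 1 := by
      refine lt_of_mul_lt_mul_left ?_ hb0.le
      have : β * (β ^ 3 * v - 1) = β ^ 4 * v - β - 1 + 1 := by ring
      rw [this]; linarith
    intro j h0 hj
    interval_cases j <;>
      simp only [Function.iterate_succ, Function.iterate_zero, Function.comp, id, t1, t2, t3, t4,
        t5] <;>
      linarith
  · intro l hl hw hc
    rcases l with _ | ⟨a, _ | ⟨b, _ | ⟨c, _ | ⟨d, l⟩⟩⟩⟩ <;>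
      simp only [blockLength_cons, blockLength_nil] at hw
    · exact hl rfl
    · omega
    · omega
    · obtain ⟨rfl, rfl, rfl⟩ : a = 0 ∧ b = 0 ∧ c = 0 := by omega
      exact absurd (hc 3 0 rfl) (by norm_num)
    · omega
  -- The bounds `v < y < r²` force the first five digits 00110. A last digit 1 gives `y = v`, and a
  -- last digit 0 gives a smaller point.
  · intro y hy hvy hper
    obtain ⟨s1, s2⟩ := h.betaMap_zero_zero (hv0.trans hvy).le hy
    have hm2 : β ^ 2 * y ∈ Set.Ico (0 : ℝ) 1 := by rw [← s2]; exact betaMap_mem _ _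
    have g3 : β ^ 3 * v < β ^ 3 * y := by gcongr
    have g4 : β ^ 4 * v < β ^ 4 * y := by gcongr
    have s3 : betaMap β (β ^ 2 * y) = β ^ 3 * y - 1 := by
      have e0 : β * (β ^ 2 * y) = β ^ 3 * y := by ring
      rcases h.betaMap_cases hm2 with ⟨e, e'⟩ | ⟨e, -⟩
      · linarith
      · linarith
    have hm3 : β ^ 3 * y - 1 ∈ Set.Ico (0 : ℝ) 1 := by rw [← s3]; exact betaMap_mem _ _
    have s4 : betaMap β (β ^ 3 * y - 1) = β ^ 4 * y - β - 1 := by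
      have e0 : β * (β ^ 3 * y - 1) = β ^ 4 * y - β := by ring
      rcases h.betaMap_cases hm3 with ⟨e, e'⟩ | ⟨e, -⟩
      · linarith
      · linarith
    have hm4 : β ^ 4 * y - β - 1 ∈ Set.Ico (0 : ℝ) 1 := by rw [← s4]; exact betaMap_mem _ _
    have y4 : β ^ 4 * y < β + 1 + r := by
      have : β ^ 4 * y < β ^ 4 * r ^ 2 := by gcongr
      have e : β ^ 4 * r ^ 2 = β ^ 2 := by linear_combination β ^ 2 * hr2
      rw [h.inv_eq]; linarith
    have s5 : betaMap β (β ^ 4 * y - β - 1) = β ^ 5 * y - β ^ 2 - β := by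
      have e0 : β * (β ^ 4 * y - β - 1) = β ^ 5 * y - β ^ 2 - β := by ring
      have e1 : β * (β ^ 4 * y - β - 1) < β * r := by gcongr; linarith
      rw [h.mul_eq] at e1
      rcases h.betaMap_cases hm4 with ⟨e, -⟩ | ⟨e, e'⟩
      · linarith
      · linarith
    have hm5 : β ^ 5 * y - β ^ 2 - β ∈ Set.Ico (0 : ℝ) 1 := by
      rw [← s5]; exact betaMap_mem _ _
    simp only [Function.iterate_succ, Function.iterate_zero, Function.comp, id, s1, s2, s3, s4,
      s5] at hper
    have g : (β ^ 6 - 1) * v < (β ^ 6 - 1) * y := by gcongr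
    rcases h.betaMap_cases hm5 with ⟨e, -⟩ | ⟨e, -⟩ <;> rw [e] at hper <;> linarith

end IsTribonacci

/-! ### Closed forms -/

theorem criticalValue_eq {β v : ℝ} {p : ℕ} (hg : IsGreatest (periodHoles β p) v) :
    criticalValue β p = v :=
  hg.csSup_eq

namespace IsTribonacci

variable {β r : ℝ} (h : IsTribonacci β r)
include h

theorem pow_mul_pow (a b : ℕ) : r ^ a * β ^ (a + b) = β ^ b := by
  rw [pow_add, ← mul_assoc, ← mul_pow, mul_comm r β, h.mul_eq, one_pow, one_mul]

/-- Here `σ` collects the powers of `β` contributed by the blocks after the first. As `(1 - β³)r⁴ =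
r - 1`, each `β^j` in `σ` becomes `β^j - β^(j-1)` in the numerator. -/
theorem sub_cycleGap_eq {w : List ℕ} {p : ℕ} {σ : ℝ} (hw : w ≠ []) (hp : blockLength w = p)
    (hσ : blockGap r w 0 * β ^ p = r ^ 4 * (β ^ p + σ)) :
    r - cycleGap r w = (1 + β - β ^ p * (r + β) + (1 - r) * σ) / ((1 - β ^ 3) * (β ^ p - 1)) := by
  have hp0 : 0 < p := hp ▸ blockLength_pos hw
  have hq := h.one_sub_pow_pos hp0
  have hQ : r ^ p * β ^ p = 1 := h.pow_mul_pow p 0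
  have h1 : (1 : ℝ) < β ^ p := one_lt_pow₀ h.one_lt hp0.ne'
  have h2 : (1 : ℝ) < β ^ 3 := one_lt_pow₀ h.one_lt (by norm_num)
  have hne : (1 - β ^ 3) * (β ^ p - 1) ≠ 0 :=
    mul_ne_zero (by linarith) (by linarith)
  have hc : cycleGap r w * (1 - r ^ p) = blockGap r w 0 := by
    unfold cycleGap
    rw [hp, div_mul_cancel₀ _ hq.ne']
  have hc2 : cycleGap r w * (β ^ p - 1) = r ^ 4 * (β ^ p + σ) := by
    rw [← hσ, ← hc]
    linear_combination cycleGap r w * hQ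
  have k1 : (1 - β ^ 3) * r = r - β ^ 2 := by linear_combination (-β ^ 2) * h.mul_eq
  have k2 : (1 - β ^ 3) * r ^ 4 = r - 1 := by
    linear_combination h.pow_four' - r * (1 + β * r + (β * r) ^ 2) * h.mul_eq
  rw [eq_div_iff hne]
  linear_combination (β ^ p - 1) * k1 - (1 - β ^ 3) * hc2 - (β ^ p + σ) * k2 +
    (β ^ p - 1) * h.inv_eq

theorem single_eq (m : ℕ) : r - cycleGap r [m] =
    (1 + β - β ^ (3 * m + 1) - β ^ (3 * m + 3)) / ((1 - β ^ 3) * (β ^ (3 * m + 2) - 1)) := by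
  rw [h.sub_cycleGap_eq (w := [m]) (p := 3 * m + 2) (σ := 0) (by simp) (by simp; ring)
    (by simp [blockGap])]
  congr 1
  linear_combination (-β ^ (3 * m + 1)) * h.mul_eq

theorem pair_one_eq (z : ℕ) : r - cycleGap r [z, z + 1] =
    (1 + β + β ^ (3 * z + 5) - β ^ (3 * z + 4) - β ^ (6 * z + 6) - β ^ (6 * z + 8)) /
      ((1 - β ^ 3) * (β ^ (6 * z + 7) - 1)) := by
  rw [h.sub_cycleGap_eq (w := [z, z + 1]) (p := 6 * z + 7) (σ := β ^ (3 * z + 5)) (by simp)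
    (by simp; ring) ?_]
  · congr 1
    linear_combination (-β ^ (6 * z + 6) - β ^ (3 * z + 4)) * h.mul_eq
  · simp only [blockGap]
    have e1 := h.pow_mul_pow (2 + 3 * z) (3 * z + 5)
    rw [show 2 + 3 * z + (3 * z + 5) = 6 * z + 7 by ring] at e1
    linear_combination r ^ 4 * e1

theorem pair_two_eq (z : ℕ) : r - cycleGap r [z, z + 2] =
    (1 + β + β ^ (3 * z + 8) - β ^ (3 * z + 7) - β ^ (6 * z + 9) - β ^ (6 * z + 11)) /
      ((1 - β ^ 3) * (β ^ (6 * z + 10) - 1)) := by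
  rw [h.sub_cycleGap_eq (w := [z, z + 2]) (p := 6 * z + 10) (σ := β ^ (3 * z + 8)) (by simp)
    (by simp; ring) ?_]
  · congr 1
    linear_combination (-β ^ (6 * z + 9) - β ^ (3 * z + 7)) * h.mul_eq
  · simp only [blockGap]
    have e1 := h.pow_mul_pow (2 + 3 * z) (3 * z + 8)
    rw [show 2 + 3 * z + (3 * z + 8) = 6 * z + 10 by ring] at e1
    linear_combination r ^ 4 * e1

theorem triple_one_eq (z : ℕ) : r - cycleGap r [z, z, z + 1] =
    (1 + β + β ^ (3 * z + 5) + β ^ (6 * z + 7) - β ^ (3 * z + 4) - β ^ (6 * z + 6)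
      - β ^ (9 * z + 8) - β ^ (9 * z + 10)) / ((1 - β ^ 3) * (β ^ (9 * z + 9) - 1)) := by
  rw [h.sub_cycleGap_eq (w := [z, z, z + 1]) (p := 9 * z + 9)
    (σ := β ^ (6 * z + 7) + β ^ (3 * z + 5)) (by simp) (by simp; ring) ?_]
  · congr 1
    linear_combination (-β ^ (9 * z + 8) - β ^ (3 * z + 4) - β ^ (6 * z + 6)) * h.mul_eq
  · simp only [blockGap]
    have e1 := h.pow_mul_pow (2 + 3 * z) (6 * z + 7)
    have e2 := h.pow_mul_pow (2 + 3 * z) (3 * z + 5)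
    rw [show 2 + 3 * z + (3 * z + 5) = 6 * z + 7 by ring] at e2
    rw [show 2 + 3 * z + (6 * z + 7) = 9 * z + 9 by ring] at e1
    linear_combination r ^ 4 * e1 + r ^ 4 * r ^ (2 + 3 * z) * e1 + r ^ 4 * e2

theorem triple_two_eq (z : ℕ) : r - cycleGap r [z, z + 1, z + 1] =
    (1 + β + β ^ (3 * z + 5) + β ^ (6 * z + 10) - β ^ (3 * z + 4) - β ^ (6 * z + 9)
      - β ^ (9 * z + 11) - β ^ (9 * z + 13)) / ((1 - β ^ 3) * (β ^ (9 * z + 12) - 1)) := by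
  rw [h.sub_cycleGap_eq (w := [z, z + 1, z + 1]) (p := 9 * z + 12)
    (σ := β ^ (6 * z + 10) + β ^ (3 * z + 5)) (by simp) (by simp; ring) ?_]
  · congr 1
    linear_combination (-β ^ (9 * z + 11) - β ^ (3 * z + 4) - β ^ (6 * z + 9)) * h.mul_eq
  · simp only [blockGap]
    have e1 := h.pow_mul_pow (2 + 3 * z) (6 * z + 10)
    have e2 := h.pow_mul_pow (2 + 3 * (z + 1)) (3 * z + 5)
    rw [show 2 + 3 * (z + 1) + (3 * z + 5) = 6 * z + 10 by ring] at e2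
    rw [show 2 + 3 * z + (6 * z + 10) = 9 * z + 12 by ring] at e1
    linear_combination r ^ 4 * e1 + r ^ 4 * r ^ (2 + 3 * (z + 1)) * e1 + r ^ 4 * e2

theorem triple_three_eq (z : ℕ) : r - cycleGap r [z, z + 2, z + 1] =
    (1 + β + β ^ (3 * z + 5) + β ^ (6 * z + 13) - β ^ (3 * z + 4) - β ^ (6 * z + 12)
      - β ^ (9 * z + 14) - β ^ (9 * z + 16)) / ((1 - β ^ 3) * (β ^ (9 * z + 15) - 1)) := by
  rw [h.sub_cycleGap_eq (w := [z, z + 2, z + 1]) (p := 9 * z + 15)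
    (σ := β ^ (6 * z + 13) + β ^ (3 * z + 5)) (by simp) (by simp; ring) ?_]
  · congr 1
    linear_combination (-β ^ (9 * z + 14) - β ^ (3 * z + 4) - β ^ (6 * z + 12)) * h.mul_eq
  · simp only [blockGap]
    have e1 := h.pow_mul_pow (2 + 3 * z) (6 * z + 13)
    have e2 := h.pow_mul_pow (2 + 3 * (z + 2)) (3 * z + 5)
    rw [show 2 + 3 * (z + 2) + (3 * z + 5) = 6 * z + 13 by ring] at e2
    rw [show 2 + 3 * z + (6 * z + 13) = 9 * z + 15 by ring] at e1
    linear_combination r ^ 4 * e1 + r ^ 4 * r ^ (2 + 3 * (z + 2)) * e1 + r ^ 4 * e2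

/-! ### All periods, and the limit -/

/-- For all but four periods the critical value is attained on a coded cycle. -/
theorem isGreatest_cases {p : ℕ} (hp : 1 ≤ p) :
    (p = 1 ∨ p = 3 ∨ p = 4 ∨ p = 6) ∨
      ∃ k l, p / 3 - 2 ≤ 3 + 3 * k ∧ IsGreatest (periodHoles β p) (r - cycleGap r (k :: l)) := by
  by_cases hs : p = 1 ∨ p = 3 ∨ p = 4 ∨ p = 6
  · exact Or.inl hs
  right
  obtain ⟨w, hw⟩ : ∃ w, p = 3 * w + 2 ∨ p = 6 * w + 7 ∨ p = 6 * w + 10 ∨ p = 9 * w + 9 ∨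
      p = 9 * w + 12 ∨ p = 9 * w + 15 := by
    by_cases h2 : p % 3 = 2
    · exact ⟨p / 3, by omega⟩
    by_cases h1 : p % 3 = 1
    · by_cases h6 : p % 6 = 1
      · exact ⟨p / 6 - 1, by omega⟩
      · exact ⟨p / 6 - 1, by omega⟩
    · exact ⟨p / 9 - 1, by omega⟩
  -- The bound on the first exponent is an equality for the last family, where `p / 3 - 2 = 3w + 3`.
  rcases hw with rfl | rfl | rfl | rfl | rfl | rfl
  · exact ⟨w, _, by omega, h.isGreatest_single w⟩
  · exact ⟨w, _, by omega, h.isGreatest_pair_one w⟩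
  · exact ⟨w, _, by omega, h.isGreatest_pair_two w⟩
  · exact ⟨w, _, by omega, h.isGreatest_triple_one w⟩
  · exact ⟨w, _, by omega, h.isGreatest_triple_two w⟩
  · exact ⟨w, _, by omega, h.isGreatest_triple_three w⟩

theorem exists_isGreatest {p : ℕ} (hp : 1 ≤ p) : ∃ v, IsGreatest (periodHoles β p) v := by
  obtain (rfl | rfl | rfl | rfl) | ⟨k, l, -, hg⟩ := h.isGreatest_cases hp
  · exact ⟨_, h.isGreatest_one⟩
  · exact ⟨_, h.isGreatest_three⟩
  · exact ⟨_, h.isGreatest_four⟩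
  · exact ⟨_, h.isGreatest_six⟩
  · exact ⟨_, hg⟩

theorem limit_eq : (β ^ 2 + 1) / (β ^ 4 - β) = r - r ^ 4 := by
  have h1 : (1 : ℝ) < β ^ 3 := one_lt_pow₀ h.one_lt (by norm_num)
  have hb := h.one_lt
  have hne : β ^ 4 - β ≠ 0 := by
    have : β ^ 4 - β = β * (β ^ 3 - 1) := by ring
    rw [this]
    exact mul_ne_zero (by linarith) (by linarith)
  rw [div_eq_iff hne, h.pow_four']
  linear_combination (β ^ 3 - 1) * h.mul_eq - β * h.pow_three_eq

theorem tendsto_criticalValue :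
    Tendsto (fun p : ℕ => criticalValue β p) atTop (𝓝 ((β ^ 2 + 1) / (β ^ 4 - β))) := by
  have hdiv : Tendsto (fun p : ℕ => p / 3 - 2) atTop atTop :=
    tendsto_atTop_atTop.2 fun b => ⟨3 * (b + 2), fun p hp => by omega⟩
  have hpow : Tendsto (fun p : ℕ => r ^ (p / 3 - 2)) atTop (𝓝 0) :=
    (tendsto_pow_atTop_nhds_zero_of_lt_one h.pos.le h.lt_one).comp hdiv
  rw [h.limit_eq]
  have hlow : Tendsto (fun p : ℕ => r - r ^ 4 - r ^ (p / 3 - 2)) atTop (𝓝 (r - r ^ 4)) := by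
    simpa using hpow.const_sub (r - r ^ 4)
  have hbound : ∀ᶠ p : ℕ in atTop, r - r ^ 4 - r ^ (p / 3 - 2) ≤ criticalValue β p ∧
      criticalValue β p ≤ r - r ^ 4 := by
    filter_upwards [eventually_ge_atTop 7] with p hp
    obtain hs | ⟨k, l, hk, hg⟩ := h.isGreatest_cases (p := p) (by omega)
    · omega
    rw [criticalValue_eq hg]
    have h1 := h.cycleGap_cons_le k l
    have h2 := h.lt_cycleGap (l := k :: l) (by simp)
    have h3 : r ^ (3 + 3 * k) ≤ r ^ (p / 3 - 2) :=
      pow_le_pow_of_le_one h.pos.le h.lt_one.le hk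
    constructor <;> linarith
  exact tendsto_of_tendsto_of_tendsto_of_le_of_le' hlow tendsto_const_nhds
    (hbound.mono fun _ hp => hp.1) (hbound.mono fun _ hp => hp.2)

theorem limit_approx : |(β ^ 2 + 1) / (β ^ 4 - β) - 0.45631| < 0.000005 := by
  rw [h.limit_eq, h.pow_four']
  have hr := h.pos
  have h1 : 0.543686 < r := by
    by_contra! hc
    linarith [h.sum_eq, pow_le_pow_left₀ hr.le hc 2, pow_le_pow_left₀ hr.le hc 3]
  have h2 : r < 0.543694 := by
    by_contra! hc
    linarith [h.sum_eq, pow_le_pow_left₀ (by norm_num) hc 2, pow_le_pow_left₀ (by norm_num) hc 3]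
  rw [abs_lt]
  constructor <;> linarith

/-! ### Monotonicity along residue classes modulo 3 -/

theorem sq_lt_bounds : 3.381 < β ^ 2 ∧ β ^ 2 < 3.385 := by
  have hb := h.base_gt
  have hb' := h.base_lt
  constructor <;> nlinarith

theorem criticalValue_four_lt : (1 + β) / (β ^ 4 - 1) < 0.285 := by
  have hb := h.base_gt
  have hb' := h.base_lt
  obtain ⟨q1, q2⟩ := h.sq_lt_bounds
  have h4 : β ^ 4 = 2 * β ^ 2 + 2 * β + 1 := by linear_combination (β + 1) * h.pow_three_eq
  rw [h4, div_lt_iff₀] <;> linarith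

theorem criticalValue_six_mem :
    0.27 < (1 + β ^ 2 + β ^ 3) / (β ^ 6 - 1) ∧ (1 + β ^ 2 + β ^ 3) / (β ^ 6 - 1) < 0.285 := by
  have hb := h.base_gt
  have hb' := h.base_lt
  obtain ⟨q1, q2⟩ := h.sq_lt_bounds
  have h3 := h.pow_three_eq
  have h6 : β ^ 6 = 7 * β ^ 2 + 6 * β + 4 := by
    linear_combination (β ^ 3 + β ^ 2 + 2 * β + 4) * h3
  rw [h6, h3, lt_div_iff₀ (by linarith), div_lt_iff₀ (by linarith)]
  constructor <;> linarith

theorem criticalValue_three_lt : 1 / (β ^ 3 - 1) < 0.27 := by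
  have hb := h.base_gt
  obtain ⟨q1, q2⟩ := h.sq_lt_bounds
  rw [h.pow_three_eq, div_lt_iff₀] <;> linarith

/-- Coded points are at least `r² > 0.295`, which separates them from the exceptional values at
periods 4 and 6. -/
theorem lt_sub_cycleGap {l : List ℕ} (hl : l ≠ []) : 0.285 < r - cycleGap r l := by
  have := h.cycleGap_le hl
  nlinarith [h.gt]

theorem strictMono_one : StrictMono (fun m : ℕ => criticalValue β (3 * m + 1)) := by
  refine strictMono_nat_of_lt_succ fun m => ?_
  have hb := h.one_lt
  have h4 : (1 : ℝ) < β ^ 4 := one_lt_pow₀ hb (by norm_num)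
  match m with
  | 0 =>
    simp only [Nat.mul_zero, Nat.zero_add, Nat.mul_one]
    rw [criticalValue_eq h.isGreatest_one, criticalValue_eq h.isGreatest_four]
    exact div_pos (by linarith) (by linarith)
  | 1 =>
    rw [criticalValue_eq h.isGreatest_four, criticalValue_eq (h.isGreatest_pair_one 0)]
    exact h.criticalValue_four_lt.trans (h.lt_sub_cycleGap (by simp))
  | m + 2 =>
    obtain ⟨w, rfl | rfl⟩ := m.even_or_odd'
    · rw [show 3 * (2 * w + 2) + 1 = 6 * w + 7 by ring,
        show 3 * (2 * w + 2 + 1) + 1 = 6 * w + 10 by ring,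
        criticalValue_eq (h.isGreatest_pair_one w), criticalValue_eq (h.isGreatest_pair_two w)]
      exact sub_lt_sub_left (h.cycleGap_cons_lt_iff.2 (h.cycleGap_lt_of_lt (by omega) _ _)) _
    · rw [show 3 * (2 * w + 1 + 2) + 1 = 6 * w + 10 by ring,
        show 3 * (2 * w + 1 + 2 + 1) + 1 = 6 * (w + 1) + 7 by ring,
        criticalValue_eq (h.isGreatest_pair_two w),
        criticalValue_eq (h.isGreatest_pair_one (w + 1))]
      exact sub_lt_sub_left (h.cycleGap_lt_of_lt (by omega) _ _) _

theorem strictMono_two : StrictMono (fun m : ℕ => criticalValue β (3 * m + 2)) := by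
  refine strictMono_nat_of_lt_succ fun m => ?_
  rw [criticalValue_eq (h.isGreatest_single m), criticalValue_eq (h.isGreatest_single (m + 1))]
  exact sub_lt_sub_left (h.cycleGap_lt_of_lt (by omega) _ _) _

theorem strictMono_three : StrictMono (fun m : ℕ => criticalValue β (3 * m + 3)) := by
  refine strictMono_nat_of_lt_succ fun m => ?_
  match m with
  | 0 =>
    simp only [Nat.mul_zero, Nat.zero_add, Nat.mul_one]
    rw [criticalValue_eq h.isGreatest_three, criticalValue_eq h.isGreatest_six]
    exact h.criticalValue_three_lt.trans h.criticalValue_six_mem.1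
  | 1 =>
    rw [criticalValue_eq h.isGreatest_six, criticalValue_eq (h.isGreatest_triple_one 0)]
    exact h.criticalValue_six_mem.2.trans (h.lt_sub_cycleGap (by simp))
  | m + 2 =>
    -- Adding 3 to the period runs through `[w, w, w+1]`, `[w, w+1, w+1]`, `[w, w+2, w+1]`, `[w+1,
    -- w+1, w+2]`, which increase lexicographically.
    obtain ⟨w, rfl | rfl | rfl⟩ : ∃ w, m = 3 * w ∨ m = 3 * w + 1 ∨ m = 3 * w + 2 :=
      ⟨m / 3, by omega⟩
    · rw [show 3 * (3 * w + 2) + 3 = 9 * w + 9 by ring,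
        show 3 * (3 * w + 2 + 1) + 3 = 9 * w + 12 by ring,
        criticalValue_eq (h.isGreatest_triple_one w), criticalValue_eq (h.isGreatest_triple_two w)]
      exact sub_lt_sub_left (h.cycleGap_cons_lt_iff.2 (h.cycleGap_lt_of_lt (by omega) _ _)) _
    · rw [show 3 * (3 * w + 1 + 2) + 3 = 9 * w + 12 by ring,
        show 3 * (3 * w + 1 + 2 + 1) + 3 = 9 * w + 15 by ring,
        criticalValue_eq (h.isGreatest_triple_two w),
        criticalValue_eq (h.isGreatest_triple_three w)]
      exact sub_lt_sub_left (h.cycleGap_cons_lt_iff.2 (h.cycleGap_lt_of_lt (by omega) _ _)) _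
    · rw [show 3 * (3 * w + 2 + 2) + 3 = 9 * w + 15 by ring,
        show 3 * (3 * w + 2 + 2 + 1) + 3 = 9 * (w + 1) + 9 by ring,
        criticalValue_eq (h.isGreatest_triple_three w),
        criticalValue_eq (h.isGreatest_triple_one (w + 1))]
      exact sub_lt_sub_left (h.cycleGap_lt_of_lt (by omega) _ _) _

end IsTribonacci

theorem corollary5p9 (β : ℝ) (hβ₁ : 1 < β) (hβ₂ : β < 2) (hβ : β ^ 3 = β ^ 2 + β + 1) :
    -- for every period the critical value is a genuine supremum (of a non-empty bounded set)
    (∀ p : ℕ, 1 ≤ p → (periodHoles β p).Nonempty ∧ IsLUB (periodHoles β p) (criticalValue β p)) ∧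
    -- the exceptional periods
    (criticalValue β 1 = 0 ∧
      criticalValue β 3 = 1 / (β ^ 3 - 1) ∧
      criticalValue β 4 = (1 + β) / (β ^ 4 - 1) ∧
      criticalValue β 6 = (1 + β ^ 2 + β ^ 3) / (β ^ 6 - 1)) ∧
    -- p = 3m + 2
    (∀ m : ℕ, criticalValue β (3 * m + 2) =
      (1 + β - β ^ (3 * m + 1) - β ^ (3 * m + 3)) / ((1 - β ^ 3) * (β ^ (3 * m + 2) - 1))) ∧
    -- p = 3m + 1, with m = 2z and m = 2z + 1
    (∀ z : ℕ, 1 ≤ z →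
      criticalValue β (6 * z + 1) =
        (1 + β + β ^ (3 * z + 2) - β ^ (3 * z + 1) - β ^ (6 * z) - β ^ (6 * z + 2)) /
          ((1 - β ^ 3) * (β ^ (6 * z + 1) - 1)) ∧
      criticalValue β (6 * z + 4) =
        (1 + β + β ^ (3 * z + 5) - β ^ (3 * z + 4) - β ^ (6 * z + 3) - β ^ (6 * z + 5)) /
          ((1 - β ^ 3) * (β ^ (6 * z + 4) - 1))) ∧
    -- p = 3m, with m = 3z, m = 3z + 1 and m = 3z + 2
    (∀ z : ℕ, 1 ≤ z →
      criticalValue β (9 * z) =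
        (1 + β + β ^ (3 * z + 2) + β ^ (6 * z + 1) - β ^ (3 * z + 1) - β ^ (6 * z)
            - β ^ (9 * z - 1) - β ^ (9 * z + 1)) /
          ((1 - β ^ 3) * (β ^ (9 * z) - 1)) ∧
      criticalValue β (9 * z + 3) =
        (1 + β + β ^ (3 * z + 2) + β ^ (6 * z + 4) - β ^ (3 * z + 1) - β ^ (6 * z + 3)
            - β ^ (9 * z + 2) - β ^ (9 * z + 4)) /
          ((1 - β ^ 3) * (β ^ (9 * z + 3) - 1)) ∧
      criticalValue β (9 * z + 6) =
        (1 + β + β ^ (3 * z + 2) + β ^ (6 * z + 7) - β ^ (3 * z + 1) - β ^ (6 * z + 6)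
            - β ^ (9 * z + 5) - β ^ (9 * z + 7)) /
          ((1 - β ^ 3) * (β ^ (9 * z + 6) - 1))) ∧
    -- the critical value increases along each residue class modulo 3 ...
    (StrictMono (fun m : ℕ => criticalValue β (3 * m + 1)) ∧
      StrictMono (fun m : ℕ => criticalValue β (3 * m + 2)) ∧
      StrictMono (fun m : ℕ => criticalValue β (3 * m + 3))) ∧
    -- ... and converges, along all periods, to the stated limit, which is about 0.45631
    Tendsto (fun p : ℕ => criticalValue β p) atTop (𝓝 ((β ^ 2 + 1) / (β ^ 4 - β))) ∧
    |(β ^ 2 + 1) / (β ^ 4 - β) - 0.45631| < 0.000005 := by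
  have h : IsTribonacci β β⁻¹ := isTribonacci_inv hβ₁ hβ
  refine ⟨fun p hp => ?_, ⟨criticalValue_eq h.isGreatest_one, criticalValue_eq h.isGreatest_three,
    criticalValue_eq h.isGreatest_four, criticalValue_eq h.isGreatest_six⟩,
    fun m => (criticalValue_eq (h.isGreatest_single m)).trans (h.single_eq m), fun z hz => ?_,
    fun z hz => ?_, ⟨h.strictMono_one, h.strictMono_two, h.strictMono_three⟩,
    h.tendsto_criticalValue, h.limit_approx⟩
  · obtain ⟨v, hv⟩ := h.exists_isGreatest hp
    rw [criticalValue_eq hv]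
    exact ⟨hv.nonempty, hv.isLUB⟩
  -- The closed forms are indexed by the smallest exponent, which is `z - 1`.
  · obtain ⟨z, rfl⟩ := Nat.exists_eq_add_of_le' hz
    exact ⟨(criticalValue_eq (h.isGreatest_pair_one z)).trans (h.pair_one_eq z),
      (criticalValue_eq (h.isGreatest_pair_two z)).trans (h.pair_two_eq z)⟩
  · obtain ⟨z, rfl⟩ := Nat.exists_eq_add_of_le' hz
    exact ⟨(criticalValue_eq (h.isGreatest_triple_one z)).trans (h.triple_one_eq z),
      (criticalValue_eq (h.isGreatest_triple_two z)).trans (h.triple_two_eq z),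
      (criticalValue_eq (h.isGreatest_triple_three z)).trans (h.triple_three_eq z)⟩
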